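/- Let $m\ge 1$, and call $w\in\mathfrak S_{2m}$ fully supported if $\{w(1),\dots,w(r)\}\neq\{1,\dots,r\}$ for all $1\le r<2m$. For a fully supported $w\in\mathfrak S_n$, let $X(w)$ be Elnitsky's polygon: the equilateral $2n$-gon whose sides are labeled $1,\dots,n,w(n),\dots,w(1)$ in counterclockwise order starting from its top vertex, such that the first $n$ of these sides form half of a convex $2n$-gon and sides with the same label are parallel; the sides labeled $w(1),\dots,w(n)$, running from the top vertex to the bottom vertex, form its rightside boundary. A rhombic tiling of $X(w)$ is a tiling by rhombi whose edges are congruent and parallel to sides of $X(w)$. A right-perimeter tile is a tile that shares two consecutive edges with the rightside boundary, and it is forced if it appears as a right-perimeter tile in every rhombic tiling of $X(w)$. The maximal number of forced right-perimeter tiles of a fully supported permutation in $\mathfrak S_{2m}$ is $m$. A fully supported permutation $w\in\mathfrak S_{2m}$ has $m$ forced right-perimeter tiles if and only if $w(2k-1)>w(2k)$ for all $1\le k\le m$, and $$w(1)<w(3)<\cdots<w(2m-1)\qquad\text{and}\qquad w(2)<w(4)<\cdots<w(2m).$$ -/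

import Mathlib

noncomputable section

namespace Elnitsky

/-- Admissible edge directions. The edge labeled `i` (labels are `0, …, n - 1` here) is the unit
vector with argument `θ i`. All arguments lie in `(π, 2π)`, so that every edge points strictly
downwards, and they increase strictly, so that the edges `0, 1, …, n - 1`, placed head to tail,
run counterclockwise along one half of a convex equilateral `2n`-gon, from its top vertex to its
bottom vertex. -/
def IsAdmissible {n : ℕ} (θ : Fin n → ℝ) : Prop :=
  StrictMono θ ∧ ∀ i, θ i ∈ Set.Ioo Real.pi (2 * Real.pi)

/-- The unit edge vector with label `i`, in the Euclidean plane `ℂ`. -/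
def edgeVec {n : ℕ} (θ : Fin n → ℝ) (i : Fin n) : ℂ :=
  ⟨Real.cos (θ i), Real.sin (θ i)⟩

/-- The `k`-th vertex of the path that starts in the top vertex `0` and has consecutive edges
labeled `w 0, w 1, …, w (n - 1)`. -/
def pathVertex {n : ℕ} (θ : Fin n → ℝ) (w : Equiv.Perm (Fin n)) (k : ℕ) : ℂ :=
  ∑ i : Fin n with i.val < k, edgeVec θ (w i)

/-- The `k`-th edge (counted from `0`) of that path. -/
def pathEdge {n : ℕ} (θ : Fin n → ℝ) (w : Equiv.Perm (Fin n)) (k : ℕ) : Set ℂ :=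
  segment ℝ (pathVertex θ w k) (pathVertex θ w (k + 1))

/-- The path itself, as a set of points. For the permutation `w` this is the rightside boundary of
Elnitsky's polygon of `w`; for the identity it is the leftside boundary. -/
def path {n : ℕ} (θ : Fin n → ℝ) (w : Equiv.Perm (Fin n)) : Set ℂ :=
  {z | ∃ k < n, z ∈ pathEdge θ w k}

/-- Elnitsky's polygon `X(w)` as a closed region. Its sides are labeled
`1, …, n, w(n), …, w(1)` counterclockwise from the top vertex. Both boundary paths run strictly
downwards from the top vertex to the bottom vertex, so each of them meets each height in between
exactly once, and the region consists of the points that have the leftside boundary to their left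
and the rightside boundary to their right. -/
def polygon {n : ℕ} (θ : Fin n → ℝ) (w : Equiv.Perm (Fin n)) : Set ℂ :=
  {z | ∃ p ∈ path θ 1, ∃ q ∈ path θ w,
    p.im = z.im ∧ q.im = z.im ∧ p.re ≤ z.re ∧ z.re ≤ q.re}

/-- A rhombic tile: its top vertex and its two labels `a < b`. These determine the rhombus, and
are determined by it. -/
structure Tile (n : ℕ) where
  top : ℂ
  a : Fin n
  b : Fin n
  a_lt_b : a < b

/-- The closed rhombus of a tile. -/
def Tile.carrier {n : ℕ} (θ : Fin n → ℝ) (t : Tile n) : Set ℂ :=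
  {z | ∃ r ∈ Set.Icc (0 : ℝ) 1, ∃ s ∈ Set.Icc (0 : ℝ) 1,
    z = t.top + r • edgeVec θ t.a + s • edgeVec θ t.b}

/-- The four edges of a tile. -/
def Tile.edges {n : ℕ} (θ : Fin n → ℝ) (t : Tile n) : Set (Set ℂ) :=
  {segment ℝ t.top (t.top + edgeVec θ t.a),
   segment ℝ t.top (t.top + edgeVec θ t.b),
   segment ℝ (t.top + edgeVec θ t.a) (t.top + edgeVec θ t.a + edgeVec θ t.b),
   segment ℝ (t.top + edgeVec θ t.b) (t.top + edgeVec θ t.a + edgeVec θ t.b)}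

/-- `T` is a rhombic tiling of Elnitsky's polygon of `w`: the tiles have pairwise disjoint
interiors, and their union is the polygon. -/
def IsTiling {n : ℕ} (θ : Fin n → ℝ) (w : Equiv.Perm (Fin n)) (T : Finset (Tile n)) : Prop :=
  (T : Set (Tile n)).Pairwise
      (fun s t => Disjoint (interior (s.carrier θ)) (interior (t.carrier θ))) ∧
    (⋃ t ∈ T, t.carrier θ) = polygon θ w

/-- The tile `t` shares (at least) two consecutive edges with the rightside boundary. -/
def IsRightPerimeter {n : ℕ} (θ : Fin n → ℝ) (w : Equiv.Perm (Fin n)) (t : Tile n) : Prop :=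
  ∃ k : ℕ, k + 1 < n ∧ pathEdge θ w k ∈ t.edges θ ∧ pathEdge θ w (k + 1) ∈ t.edges θ

/-- The tile `t` appears as a right-perimeter tile in every rhombic tiling. -/
def IsForcedRightPerimeter {n : ℕ} (θ : Fin n → ℝ) (w : Equiv.Perm (Fin n)) (t : Tile n) : Prop :=
  ∀ T : Finset (Tile n), IsTiling θ w T → t ∈ T ∧ IsRightPerimeter θ w t

/-- The number of forced right-perimeter tiles. -/
def numForcedRight {n : ℕ} (θ : Fin n → ℝ) (w : Equiv.Perm (Fin n)) : ℕ∞ :=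
  {t : Tile n | IsForcedRightPerimeter θ w t}.encard

/-- `w` is fully supported: no proper nonempty initial segment is mapped onto itself. -/
def FullySupported {n : ℕ} (w : Equiv.Perm (Fin n)) : Prop :=
  ∀ r : ℕ, 0 < r → r < n → w '' {i | i.val < r} ≠ {i | i.val < r}

end Elnitsky

end

/-! Both boundary paths of the polygon, and the two sides of every tile, are graphs over the depth
below the top vertex. If `w (k + 1) < w k` is a descent, the tile spanned by the edges `k` and
`k + 1` of the rightside boundary can be cut off, which leaves the polygon of the permutation with
these two values exchanged. Conversely, every dissection of a nondegenerate region contains such a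
tile: follow the boundary downwards through the tiles that touch it.

Inducting on descents, one finds that the tile of a descent belongs to every tiling exactly when
`w k` is a left-to-right maximum and `w (k + 1)` a right-to-left minimum. Two such descents are
never adjacent, so there are at most `m` of them in a permutation of `2m` letters, and `m` of them
only if they begin at every second index. -/

noncomputable section

namespace Elnitsky

/-! ### Descents of a permutation -/

section

variable {n : ℕ} {w : Equiv.Perm (Fin n)}

/-- A descent of `w`, recorded by its position `pos`, counted from `0`. -/
@[ext]
structure Descent (w : Equiv.Perm (Fin n)) where
  pos : ℕ
  pos_lt : pos + 1 < n
  lt : w ⟨pos + 1, pos_lt⟩ < w ⟨pos, by omega⟩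

namespace Descent

/-- The first of the two indices of a descent. -/
abbrev fst (k : Descent w) : Fin n := ⟨k.pos, Nat.lt_of_succ_lt k.pos_lt⟩

/-- The second of the two indices of a descent. -/
abbrev snd (k : Descent w) : Fin n := ⟨k.pos + 1, k.pos_lt⟩

/-- The permutation whose one-line notation is that of `w` with the two values of the descent
exchanged. -/
def swap (k : Descent w) : Equiv.Perm (Fin n) := w * Equiv.swap k.fst k.snd

theorem swap_fst (k : Descent w) : k.swap k.fst = w k.snd := by simp [swap]

theorem swap_snd (k : Descent w) : k.swap k.snd = w k.fst := by simp [swap]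

theorem swap_apply_swap (k : Descent w) (i : Fin n) :
    k.swap (Equiv.swap k.fst k.snd i) = w i := by simp [swap]

theorem swap_of_ne (k : Descent w) {i : Fin n} (h : i.val ≠ k.pos) (h' : i.val ≠ k.pos + 1) :
    k.swap i = w i := by
  rw [swap, Equiv.Perm.mul_apply, Equiv.swap_apply_of_ne_of_ne] <;> simpa [Fin.ext_iff]

theorem swap_fst_snd_val_lt_iff (k : Descent w) {r : ℕ} (hr : r ≠ k.pos + 1) (i : Fin n) :
    (Equiv.swap k.fst k.snd i).val < r ↔ i.val < r := by
  rw [Equiv.swap_apply_def]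
  split_ifs with h h' <;> simp only [Fin.ext_iff] at * <;> omega

theorem toLex_swap_lt (k : Descent w) : toLex ⇑k.swap < toLex ⇑w :=
  Pi.lex_desc (Fin.mk_le_mk.2 k.pos.le_succ) k.lt

/-- The two descents do not involve a common index. -/
def Apart (j k : Descent w) : Prop := j.pos + 1 < k.pos ∨ k.pos + 1 < j.pos

theorem apart_of_not_adjacent {j k : Descent w} (h : j ≠ k) (hj : j.pos ≠ k.pos + 1)
    (hk : k.pos ≠ j.pos + 1) : j.Apart k := by
  have := mt Descent.ext h
  unfold Apart
  omega

/-- The descent `k`, seen as a descent of the permutation obtained by undoing the descent `j`. -/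
def inSwap (k j : Descent w) (h : j.Apart k) : Descent j.swap where
  pos := k.pos
  pos_lt := k.pos_lt
  lt := by
    unfold Apart at h
    rw [swap_of_ne, swap_of_ne]
    · exact k.lt
    all_goals dsimp only; omega

theorem swap_apply_fst {j k : Descent w} (h : j.Apart k) : j.swap k.fst = w k.fst :=
  j.swap_of_ne (by unfold Apart at h; dsimp only; omega) (by unfold Apart at h; dsimp only; omega)

theorem swap_apply_snd {j k : Descent w} (h : j.Apart k) : j.swap k.snd = w k.snd :=
  j.swap_of_ne (by unfold Apart at h; dsimp only; omega) (by unfold Apart at h; dsimp only; omega)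

/-- A record descent: a left-to-right maximum immediately followed by a right-to-left minimum. -/
def IsRecord (k : Descent w) : Prop :=
  (∀ i < k.fst, w i < w k.fst) ∧ ∀ i, k.snd < i → w k.snd < w i

theorem IsRecord.not_adjacent {k : Descent w} (hk : k.IsRecord) (j : Descent w) :
    j.pos ≠ k.pos + 1 ∧ k.pos ≠ j.pos + 1 := by
  constructor <;> intro h
  · have hi : j.fst = k.snd := Fin.ext h
    exact (hk.2 j.snd (Fin.lt_def.2 (by dsimp only; omega))).not_gt (hi ▸ j.lt)
  · have hi : j.snd = k.fst := Fin.ext h.symm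
    exact (hk.1 j.fst (Fin.lt_def.2 (by dsimp only; omega))).not_gt (hi ▸ j.lt)

theorem isRecord_inSwap_iff {j k : Descent w} (h : j.Apart k) :
    (k.inSwap j h).IsRecord ↔ k.IsRecord := by
  have hfst : k.pos ≠ j.pos + 1 := by unfold Apart at h; omega
  have hsnd : k.pos + 2 ≠ j.pos + 1 := by unfold Apart at h; omega
  refine and_congr (Equiv.forall_congr (Equiv.swap j.fst j.snd) fun i => ?_).symm
    (Equiv.forall_congr (Equiv.swap j.fst j.snd) fun i => ?_).symm
  · rw [swap_apply_swap]
    change _ ↔ (Equiv.swap j.fst j.snd i).val < k.pos → w i < j.swap k.fst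
    rw [swap_apply_fst h, swap_fst_snd_val_lt_iff _ hfst]
    rfl
  · have hlt : k.pos + 1 < (Equiv.swap j.fst j.snd i).val ↔ k.pos + 1 < i.val := by
      have hle := j.swap_fst_snd_val_lt_iff hsnd i
      omega
    rw [swap_apply_swap]
    change _ ↔ k.pos + 1 < (Equiv.swap j.fst j.snd i).val → j.swap k.snd < w i
    rw [swap_apply_snd h, hlt]
    rfl

end Descent

theorem strictMonoOn_of_forall_descent {s : Set (Fin n)} (hs : s.OrdConnected)
    (h : ∀ k : Descent w, k.fst ∈ s → k.snd ∉ s) : StrictMonoOn w s :=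
  strictMonoOn_of_lt_succ hs fun i hmax hi hi' => by
    have hsucc : i.val + 1 = (Order.succ i).val :=
      Order.covBy_iff_add_one_eq.1 (Fin.covBy_iff.1 (Order.covBy_succ_of_not_isMax hmax))
    have hi_lt : i.val + 1 < n := hsucc.trans_lt (Order.succ i).isLt
    rw [show Order.succ i = ⟨i.val + 1, hi_lt⟩ from Fin.ext hsucc.symm] at hi' ⊢
    refine (not_lt.1 fun hlt => h ⟨i, hi_lt, hlt⟩ hi hi').lt_of_ne (w.injective.ne ?_)
    exact Fin.ne_of_val_ne i.val.lt_succ_self.ne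

theorem eq_one_of_isEmpty_descent (h : IsEmpty (Descent w)) : w = 1 := by
  have hw : StrictMono w := strictMonoOn_univ.1 <|
    strictMonoOn_of_forall_descent Set.ordConnected_univ fun k => h.elim k
  exact Equiv.ext fun i => DFunLike.congr_fun
    (Subsingleton.elim (hw.orderIsoOfSurjective w w.surjective) (OrderIso.refl _)) i

theorem Descent.isRecord_of_forall_eq {k : Descent w} (h : ∀ j : Descent w, j = k) :
    k.IsRecord := by
  constructor
  · refine fun i hi => strictMonoOn_of_forall_descent Set.ordConnected_Iic (fun j _ hj => ?_)
      (Set.mem_Iic.2 hi.le) Set.self_mem_Iic hi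
    rw [h j] at hj
    exact k.pos.lt_succ_self.not_ge hj
  · refine fun i hi => strictMonoOn_of_forall_descent Set.ordConnected_Ici (fun j hj _ => ?_)
      Set.self_mem_Ici (Set.mem_Ici.2 hi.le) hi
    rw [h j] at hj
    exact k.pos.lt_succ_self.not_ge hj

theorem descent_induction {P : Equiv.Perm (Fin n) → Prop}
    (step : ∀ w, (∀ k : Descent w, P k.swap) → P w) (w : Equiv.Perm (Fin n)) : P w :=
  (InvImage.wf (fun w : Equiv.Perm (Fin n) => toLex ⇑w) wellFounded_lt).induction w
    fun w ih => step w fun k => ih k.swap k.toLex_swap_lt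

/-! ### Counting record descents -/

namespace Descent

theorem injOn_pos_div_two : Set.InjOn (fun k : Descent w => k.pos / 2) {k | k.IsRecord} := by
  intro j hj k _ hjk
  have := IsRecord.not_adjacent hj k
  dsimp only at hjk
  exact Descent.ext (by omega)

theorem mapsTo_pos_div_two :
    Set.MapsTo (fun k : Descent w => k.pos / 2) {k | k.IsRecord} (Finset.range (n / 2)) := by
  intro k _
  have := k.pos_lt
  simp only [Finset.coe_range, Set.mem_Iio]
  omega

theorem encard_isRecord_le (w : Equiv.Perm (Fin n)) :
    {k : Descent w | k.IsRecord}.encard ≤ (n / 2 : ℕ) := by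
  have h := Set.encard_le_encard_of_injOn (mapsTo_pos_div_two (w := w)) injOn_pos_div_two
  rwa [Set.encard_coe_eq_coe_finsetCard, Finset.card_range] at h

variable {m : ℕ} {w : Equiv.Perm (Fin (2 * m))}

theorem exists_pos_eq_of_encard_isRecord_eq (h : {k : Descent w | k.IsRecord}.encard = m)
    {i : ℕ} (hi : i < m) : ∃ k : Descent w, k.IsRecord ∧ k.pos = 2 * i := by
  have himage : (fun k : Descent w => k.pos / 2) '' {k | k.IsRecord} = Finset.range m := by
    have hsub := (mapsTo_pos_div_two (w := w)).image_subset
    rw [Nat.mul_div_cancel_left m two_pos] at hsub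
    refine ((Finset.finite_toSet _).subset hsub).eq_of_subset_of_encard_le hsub ?_
    rw [injOn_pos_div_two.encard_image, h, Set.encard_coe_eq_coe_finsetCard, Finset.card_range]
  induction hj : m - i generalizing i with
  | zero => omega
  | succ j ih =>
    obtain ⟨k, hk, hki⟩ : i ∈ (fun k : Descent w => k.pos / 2) '' {k | k.IsRecord} := by
      simpa [himage] using hi
    have hpos := k.pos_lt
    dsimp only at hki
    refine ⟨k, hk, by_contra fun hne => ?_⟩
    obtain ⟨l, -, hl⟩ := ih (i := i + 1) (by omega) (by omega)
    have := (IsRecord.not_adjacent hk l).1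
    omega

theorem encard_isRecord_eq_iff : {k : Descent w | k.IsRecord}.encard = m ↔
    ∀ i < m, ∃ k : Descent w, k.IsRecord ∧ k.pos = 2 * i := by
  refine ⟨fun h i => exists_pos_eq_of_encard_isRecord_eq h, fun h => le_antisymm ?_ ?_⟩
  · simpa using encard_isRecord_le w
  · have hsub : (Finset.range m : Set ℕ) ⊆
        (fun k : Descent w => k.pos / 2) '' {k | k.IsRecord} := by
      intro i hi
      obtain ⟨k, hk, hki⟩ := h i (by simpa using hi)
      exact ⟨k, hk, by simp [hki]⟩
    have := (Set.encard_le_encard hsub).trans (Set.encard_image_le _ _)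
    rwa [Set.encard_coe_eq_coe_finsetCard, Finset.card_range] at this

theorem two_mul_val_lt (i : Fin m) : 2 * i.val < 2 * m := Nat.mul_lt_mul_of_pos_left i.isLt two_pos

theorem two_mul_val_add_one_lt (i : Fin m) : 2 * i.val + 1 < 2 * m := by
  have := i.isLt
  omega

theorem forall_exists_isRecord_iff :
    (∀ i < m, ∃ k : Descent w, k.IsRecord ∧ k.pos = 2 * i) ↔
      (∀ k : Fin m, w ⟨2 * k.val, two_mul_val_lt k⟩ > w ⟨2 * k.val + 1, two_mul_val_add_one_lt k⟩) ∧
        StrictMono (fun k : Fin m => w ⟨2 * k.val, two_mul_val_lt k⟩) ∧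
        StrictMono (fun k : Fin m => w ⟨2 * k.val + 1, two_mul_val_add_one_lt k⟩) := by
  constructor
  · intro h
    choose k hrec hpos using fun i : Fin m => h i.val i.isLt
    have hfst : ∀ i, (k i).fst = ⟨2 * i.val, two_mul_val_lt i⟩ := fun i => Fin.ext (hpos i)
    have hsnd : ∀ i, (k i).snd = ⟨2 * i.val + 1, two_mul_val_add_one_lt i⟩ := fun i =>
      Fin.ext (congrArg (· + 1) (hpos i))
    refine ⟨fun i => ?_, fun i j hij => ?_, fun i j hij => ?_⟩
    · simpa only [← hfst, ← hsnd] using (k i).lt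
    · simpa only [← hfst] using (hrec j).1 (k i).fst (by rw [hfst, hfst, Fin.mk_lt_mk]; omega)
    · simpa only [← hsnd] using (hrec i).2 (k j).snd (by rw [hsnd, hsnd, Fin.mk_lt_mk]; omega)
  · rintro ⟨hdesc, hfst, hsnd⟩ i hi
    have hparity : ∀ l : Fin (2 * m), ∃ j : Fin m,
        l = ⟨2 * j.val, two_mul_val_lt j⟩ ∨ l = ⟨2 * j.val + 1, two_mul_val_add_one_lt j⟩ :=
      fun l => ⟨⟨l.val / 2, by omega⟩, by simp only [Fin.ext_iff]; omega⟩
    refine ⟨⟨2 * i, by omega, hdesc ⟨i, hi⟩⟩, ⟨fun l hl => ?_, fun l hl => ?_⟩, rfl⟩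
    · obtain ⟨j, rfl | rfl⟩ := hparity l
      all_goals
        have hji : w ⟨2 * j.val, two_mul_val_lt j⟩ < w ⟨2 * i, by omega⟩ :=
          hfst (show j < ⟨i, hi⟩ by simp only [Fin.lt_def] at hl ⊢; omega)
      exacts [hji, (hdesc j).trans hji]
    · obtain ⟨j, rfl | rfl⟩ := hparity l
      all_goals
        have hij : w ⟨2 * i + 1, by omega⟩ < w ⟨2 * j.val + 1, two_mul_val_add_one_lt j⟩ :=
          hsnd (show ⟨i, hi⟩ < j by simp only [Fin.lt_def] at hl ⊢; omega)
      exacts [hij.trans (hdesc j), hij]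

end Descent

/-- The permutation with one-line notation `m, 0, m + 1, 1, …, 2m - 1, m - 1` (values counted from
`0`): a fully supported permutation with the largest possible number of record descents. -/
def interleave (m : ℕ) : Equiv.Perm (Fin (2 * m)) :=
  Equiv.ofBijective
    (fun i => ⟨if i.val % 2 = 0 then m + i.val / 2 else i.val / 2, by split_ifs <;> omega⟩)
    (Finite.injective_iff_bijective.1 fun i j h => by
      have h := congrArg Fin.val h
      ext
      dsimp only at h
      split_ifs at h <;> omega)

section interleave

variable {m : ℕ}

theorem interleave_even {k : ℕ} (hk : 2 * k < 2 * m) :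
    (interleave m ⟨2 * k, hk⟩).val = m + k := by
  simp [interleave]

theorem interleave_odd {k : ℕ} (hk : 2 * k + 1 < 2 * m) :
    (interleave m ⟨2 * k + 1, hk⟩).val = k := by
  have h1 : (2 * k + 1) % 2 = 1 := by omega
  have h2 : (2 * k + 1) / 2 = k := by omega
  simp [interleave, h1, h2]

theorem fullySupported_interleave : FullySupported (interleave m) := by
  intro r h0 hr h
  have hlt : ∀ k, 2 * k < r → m + k < r := by
    intro k hk
    have : interleave m ⟨2 * k, by omega⟩ ∈ interleave m '' {i | i.val < r} :=
      Set.mem_image_of_mem _ hk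
    rw [h] at this
    simpa [interleave_even] using this
  have h1 := hlt 0 h0
  have h2 := hlt (r - m) (by omega)
  omega

theorem encard_isRecord_interleave :
    {k : Descent (interleave m) | k.IsRecord}.encard = m := by
  refine Descent.encard_isRecord_eq_iff.2 (Descent.forall_exists_isRecord_iff.2
    ⟨fun k => ?_, fun i j hij => ?_, fun i j hij => ?_⟩)
  · rw [gt_iff_lt, Fin.lt_def, interleave_even, interleave_odd]
    omega
  · rw [Fin.lt_def, interleave_even, interleave_even]
    omega
  · rwa [Fin.lt_def, interleave_odd, interleave_odd]

end interleave

end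

/-! ### Boundary paths as graphs over the depth -/

section

open Set

variable {n : ℕ} {θ : Fin n → ℝ} {w : Equiv.Perm (Fin n)} {k : ℕ} {d x : ℝ}

/-- The vertical extent of the edge labeled `i`. -/
def drop (θ : Fin n → ℝ) (i : Fin n) : ℝ := -Real.sin (θ i)

/-- The horizontal displacement per unit of depth along the edge labeled `i`. -/
def slope (θ : Fin n → ℝ) (i : Fin n) : ℝ := Real.cos (θ i) / drop θ i

/-- The vertical extent of Elnitsky's polygon. -/
def height (θ : Fin n → ℝ) : ℝ := ∑ i, drop θ i

/-- The depth of the `k`-th vertex of the path below the top vertex. -/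
def depth (θ : Fin n → ℝ) (w : Equiv.Perm (Fin n)) (k : ℕ) : ℝ := -(pathVertex θ w k).im

/-- The horizontal coordinate of the path at depth `d`. The clamped factor in the `i`-th summand is
the vertical extent of the part of the `i`-th edge that lies above depth `d`. -/
def profile (θ : Fin n → ℝ) (w : Equiv.Perm (Fin n)) (d : ℝ) : ℝ :=
  ∑ i, slope θ (w i) * max 0 (min (d - depth θ w i) (drop θ (w i)))

/-- The horizontal coordinate at depth `d` of the path that starts at `p` and consists of an edge
labeled `i` followed by an edge labeled `j`, both prolonged beyond their free ends. -/
def elbow (θ : Fin n → ℝ) (p : ℂ) (i j : Fin n) (d : ℝ) : ℝ :=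
  p.re + slope θ i * (d + p.im) + (slope θ j - slope θ i) * max 0 (d + p.im - drop θ i)

/-- The point of the plane with depth `d` and horizontal coordinate `x`. -/
def point (d x : ℝ) : ℂ := ⟨x, -d⟩

@[simp] theorem point_re (d x : ℝ) : (point d x).re = x := rfl

@[simp] theorem point_im (d x : ℝ) : (point d x).im = -d := rfl

theorem exists_eq_point (z : ℂ) : ∃ d x, z = point d x :=
  ⟨-z.im, z.re, Complex.ext rfl (neg_neg _).symm⟩

theorem continuous_point_comp {f g : ℝ → ℝ} (hf : Continuous f) (hg : Continuous g) :
    Continuous fun t => point (f t) (g t) :=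
  Complex.equivRealProdCLM.symm.continuous.comp (hg.prodMk hf.neg)

theorem IsAdmissible.drop_pos (hθ : IsAdmissible θ) (i : Fin n) : 0 < drop θ i := by
  have h := Real.sin_pos_of_pos_of_lt_pi (sub_pos.2 (hθ.2 i).1) (by linarith [(hθ.2 i).2])
  rwa [Real.sin_sub_pi] at h

theorem IsAdmissible.slope_mul_drop (hθ : IsAdmissible θ) (i : Fin n) :
    slope θ i * drop θ i = Real.cos (θ i) :=
  div_mul_cancel₀ _ (hθ.drop_pos i).ne'

theorem IsAdmissible.slope_strictMono (hθ : IsAdmissible θ) : StrictMono (slope θ) := by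
  intro i j hij
  have hsin : 0 < Real.sin (θ j - θ i) := Real.sin_pos_of_pos_of_lt_pi
    (sub_pos.2 (hθ.1 hij)) (by linarith [(hθ.2 i).1, (hθ.2 j).2])
  rw [Real.sin_sub] at hsin
  rw [slope, slope, div_lt_div_iff₀ (hθ.drop_pos i) (hθ.drop_pos j), drop, drop]
  linarith

@[simp] theorem edgeVec_re (i : Fin n) : (edgeVec θ i).re = Real.cos (θ i) := rfl

@[simp] theorem edgeVec_im (i : Fin n) : (edgeVec θ i).im = -drop θ i := (neg_neg _).symm

theorem pathVertex_zero (w : Equiv.Perm (Fin n)) : pathVertex θ w 0 = 0 := by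
  simp [pathVertex]

theorem pathVertex_succ (w : Equiv.Perm (Fin n)) (hk : k < n) :
    pathVertex θ w (k + 1) = pathVertex θ w k + edgeVec θ (w ⟨k, hk⟩) := by
  have h : (Finset.univ.filter fun i : Fin n => i.val < k + 1) =
      insert ⟨k, hk⟩ (Finset.univ.filter fun i : Fin n => i.val < k) := by
    ext i
    simp only [Finset.mem_filter_univ, Finset.mem_insert, Fin.ext_iff]
    omega
  rw [pathVertex, h, Finset.sum_insert (by simp), add_comm, pathVertex]

theorem pathVertex_mul (w : Equiv.Perm (Fin n)) {σ : Equiv.Perm (Fin n)}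
    (h : ∀ i, (σ i).val < k ↔ i.val < k) : pathVertex θ (w * σ) k = pathVertex θ w k :=
  Finset.sum_equiv σ (by simpa using fun i => (h i).symm) (by simp)

theorem pathVertex_swap (j : Descent w) (hk : k ≠ j.pos + 1) :
    pathVertex θ j.swap k = pathVertex θ w k :=
  pathVertex_mul w (j.swap_fst_snd_val_lt_iff hk)

theorem depth_zero (w : Equiv.Perm (Fin n)) : depth θ w 0 = 0 := by
  simp [depth, pathVertex_zero]

theorem depth_succ (w : Equiv.Perm (Fin n)) (hk : k < n) :
    depth θ w (k + 1) = depth θ w k + drop θ (w ⟨k, hk⟩) := by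
  simp only [depth, pathVertex_succ w hk, Complex.add_im, edgeVec_im]
  ring

theorem depth_last (w : Equiv.Perm (Fin n)) : depth θ w n = height θ := by
  simp [depth, pathVertex, height, Equiv.sum_comp w (drop θ)]

theorem depth_swap (j : Descent w) (hk : k ≠ j.pos + 1) : depth θ j.swap k = depth θ w k := by
  rw [depth, pathVertex_swap j hk, depth]

theorem depth_strictMonoOn (hθ : IsAdmissible θ) (w : Equiv.Perm (Fin n)) :
    StrictMonoOn (depth θ w) (Iic n) :=
  strictMonoOn_Iic_of_lt_succ fun k hk => by
    rw [Order.succ_eq_add_one, depth_succ w hk]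
    exact lt_add_of_pos_right _ (hθ.drop_pos _)

theorem depth_lt (hθ : IsAdmissible θ) (w : Equiv.Perm (Fin n)) {j k : ℕ} (hjk : j < k)
    (hk : k ≤ n) : depth θ w j < depth θ w k :=
  depth_strictMonoOn hθ w (hjk.le.trans hk) hk hjk

theorem depth_le (hθ : IsAdmissible θ) (w : Equiv.Perm (Fin n)) {j k : ℕ} (hjk : j ≤ k)
    (hk : k ≤ n) : depth θ w j ≤ depth θ w k :=
  (depth_strictMonoOn hθ w).monotoneOn (hjk.trans hk) hk hjk

theorem depth_mem_Icc (hθ : IsAdmissible θ) (w : Equiv.Perm (Fin n)) (hk : k ≤ n) :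
    depth θ w k ∈ Icc 0 (height θ) :=
  ⟨(depth_zero w).symm.trans_le (depth_le hθ w k.zero_le hk),
    (depth_le hθ w hk le_rfl).trans_eq (depth_last w)⟩

theorem exists_mem_Ico_succ {α : Type*} [LinearOrder α] {f : ℕ → α} {n : ℕ} {d : α}
    (hd : d ∈ Ico (f 0) (f n)) : ∃ k < n, d ∈ Ico (f k) (f (k + 1)) := by
  induction n with
  | zero => exact absurd hd.2 hd.1.not_gt
  | succ n ih =>
    rcases lt_or_ge d (f n) with h | h
    · obtain ⟨k, hk, hdk⟩ := ih ⟨hd.1, h⟩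
      exact ⟨k, hk.trans n.lt_succ_self, hdk⟩
    · exact ⟨n, n.lt_succ_self, h, hd.2⟩

theorem exists_mem_Ico_depth (w : Equiv.Perm (Fin n)) (hd : d ∈ Ico 0 (height θ)) :
    ∃ k < n, d ∈ Ico (depth θ w k) (depth θ w (k + 1)) :=
  exists_mem_Ico_succ (by rwa [depth_zero, depth_last])

theorem exists_mem_Icc_depth (hθ : IsAdmissible θ) (hn : 0 < n) (w : Equiv.Perm (Fin n))
    (hd : d ∈ Icc 0 (height θ)) : ∃ k < n, d ∈ Icc (depth θ w k) (depth θ w (k + 1)) := by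
  rcases hd.2.eq_or_lt with rfl | h
  · refine ⟨n - 1, by omega, (depth_mem_Icc hθ w (by omega)).2, ?_⟩
    rw [Nat.sub_add_cancel hn, depth_last]
  · obtain ⟨k, hk, hdk⟩ := exists_mem_Ico_depth w ⟨hd.1, h⟩
    exact ⟨k, hk, Ico_subset_Icc_self hdk⟩

theorem max_zero_min_of_le {x h : ℝ} (hh : 0 ≤ h) (hx : h ≤ x) : max 0 (min x h) = h := by
  rw [min_eq_right hx, max_eq_right hh]

theorem max_zero_min_of_nonpos {x h : ℝ} (hx : x ≤ 0) : max 0 (min x h) = 0 :=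
  max_eq_left ((min_le_left _ _).trans hx)

theorem profile_eq (hθ : IsAdmissible θ) (w : Equiv.Perm (Fin n)) (hk : k < n)
    (hd : d ∈ Icc (depth θ w k) (depth θ w (k + 1))) :
    profile θ w d = (pathVertex θ w k).re + slope θ (w ⟨k, hk⟩) * (d - depth θ w k) := by
  have hterm : ∀ i : Fin n, slope θ (w i) * max 0 (min (d - depth θ w i) (drop θ (w i))) =
      (if i.val < k then (edgeVec θ (w i)).re else 0) +
        if i = ⟨k, hk⟩ then slope θ (w ⟨k, hk⟩) * (d - depth θ w k) else 0 := by
    intro i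
    have hi := hθ.drop_pos (w i)
    rcases lt_trichotomy i.val k with hik | hik | hik
    · have hle := (depth_succ (θ := θ) w i.isLt).symm.trans_le (depth_le hθ w hik hk.le)
      rw [max_zero_min_of_le hi.le (by linarith [hd.1]), if_pos hik,
        if_neg (Fin.ne_of_val_ne hik.ne), hθ.slope_mul_drop, edgeVec_re, add_zero]
    · obtain rfl : i = ⟨k, hk⟩ := Fin.ext hik
      rw [depth_succ w hk] at hd
      rw [min_eq_left (sub_le_iff_le_add'.2 hd.2), max_eq_right (sub_nonneg.2 hd.1),
        if_neg (lt_irrefl k), if_pos rfl, zero_add]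
    · have hle := depth_le hθ w (Nat.succ_le_of_lt hik) i.isLt.le
      rw [max_zero_min_of_nonpos (by linarith [hd.2]), if_neg hik.not_gt,
        if_neg (Fin.ne_of_val_ne hik.ne'), mul_zero, add_zero]
  simp only [profile, hterm, Finset.sum_add_distrib, Finset.sum_ite_eq', Finset.mem_univ, if_true]
  rw [← Finset.sum_filter, pathVertex, Complex.re_sum]

theorem profile_depth (hθ : IsAdmissible θ) (w : Equiv.Perm (Fin n)) (hk : k ≤ n) :
    profile θ w (depth θ w k) = (pathVertex θ w k).re := by
  rcases k.eq_zero_or_pos with rfl | h0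
  · have hle : ∀ i : Fin n, depth θ w 0 - depth θ w i ≤ 0 := fun i =>
      sub_nonpos.2 (depth_le hθ w i.val.zero_le i.isLt.le)
    simp [profile, max_zero_min_of_nonpos (hle _), pathVertex_zero]
  · obtain ⟨k, rfl⟩ := Nat.exists_eq_add_of_lt h0
    simp only [zero_add] at hk ⊢
    rw [profile_eq hθ w hk ⟨depth_le hθ w k.le_succ hk, le_rfl⟩, depth_succ w hk,
      pathVertex_succ w hk, add_sub_cancel_left, hθ.slope_mul_drop, Complex.add_re, edgeVec_re]

theorem continuous_profile (w : Equiv.Perm (Fin n)) : Continuous (profile θ w) := by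
  unfold profile
  fun_prop

theorem continuous_elbow (p : ℂ) (i j : Fin n) : Continuous (elbow θ p i j) := by
  unfold elbow
  fun_prop

theorem profile_eq_elbow (hθ : IsAdmissible θ) (w : Equiv.Perm (Fin n)) (hk : k + 1 < n)
    (hd : d ∈ Icc (depth θ w k) (depth θ w (k + 2))) :
    profile θ w d = elbow θ (pathVertex θ w k) (w ⟨k, by omega⟩) (w ⟨k + 1, hk⟩) d := by
  have hlt : k < n := Nat.lt_of_succ_lt hk
  have hsucc := depth_succ (θ := θ) w hlt
  have him : (pathVertex θ w k).im = -depth θ w k := (neg_neg _).symm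
  rw [elbow, him]
  rcases le_total d (depth θ w (k + 1)) with h | h
  · rw [profile_eq hθ w hlt ⟨hd.1, h⟩, max_eq_left (by linarith)]
    ring
  · rw [profile_eq hθ w hk ⟨h, hd.2⟩, max_eq_right (by linarith), hsucc, pathVertex_succ w hlt,
      Complex.add_re, edgeVec_re, ← hθ.slope_mul_drop]
    ring

theorem point_mem_segment_edgeVec (hθ : IsAdmissible θ) (p : ℂ) (i : Fin n) :
    point d x ∈ segment ℝ p (p + edgeVec θ i) ↔
      d ∈ Icc (-p.im) (-p.im + drop θ i) ∧ x = p.re + slope θ i * (d + p.im) := by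
  have hdrop := hθ.drop_pos i
  rw [segment_eq_image', add_sub_cancel_left]
  constructor
  · rintro ⟨r, ⟨hr0, hr1⟩, hr⟩
    have hx : p.re + r * Real.cos (θ i) = x := by simpa using congrArg Complex.re hr
    have hd : p.im + -(r * drop θ i) = -d := by simpa using congrArg Complex.im hr
    refine ⟨⟨by nlinarith, by nlinarith⟩, ?_⟩
    rw [← hx, ← hθ.slope_mul_drop]
    linear_combination -slope θ i * hd
  · rintro ⟨⟨h0, h1⟩, rfl⟩
    refine ⟨(d + p.im) / drop θ i, ⟨div_nonneg (by linarith) hdrop.le, ?_⟩, ?_⟩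
    · rw [div_le_one hdrop]
      linarith
    · apply Complex.ext
      · simp [slope]
        ring
      · simp [div_mul_cancel₀ _ hdrop.ne']

theorem pathEdge_eq (w : Equiv.Perm (Fin n)) (hk : k < n) : pathEdge θ w k =
    segment ℝ (pathVertex θ w k) (pathVertex θ w k + edgeVec θ (w ⟨k, hk⟩)) := by
  rw [pathEdge, pathVertex_succ w hk]

theorem point_mem_pathEdge (hθ : IsAdmissible θ) (w : Equiv.Perm (Fin n)) (hk : k < n) :
    point d x ∈ pathEdge θ w k ↔
      d ∈ Icc (depth θ w k) (depth θ w (k + 1)) ∧ x = profile θ w d := by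
  rw [pathEdge_eq w hk, point_mem_segment_edgeVec hθ, depth_succ w hk, depth]
  refine and_congr_right fun hd => ?_
  rw [profile_eq hθ w hk (by rwa [depth_succ w hk, depth]), depth, sub_neg_eq_add]

theorem point_mem_path (hθ : IsAdmissible θ) (hn : 0 < n) (w : Equiv.Perm (Fin n)) :
    point d x ∈ path θ w ↔ d ∈ Icc 0 (height θ) ∧ x = profile θ w d := by
  constructor
  · rintro ⟨k, hk, h⟩
    rw [point_mem_pathEdge hθ w hk] at h
    exact ⟨Icc_subset_Icc (depth_mem_Icc hθ w hk.le).1 (depth_mem_Icc hθ w hk).2 h.1, h.2⟩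
  · rintro ⟨hd, hx⟩
    obtain ⟨k, hk, hdk⟩ := exists_mem_Icc_depth hθ hn w hd
    exact ⟨k, hk, (point_mem_pathEdge hθ w hk).2 ⟨hdk, hx⟩⟩

theorem point_mem_polygon (hθ : IsAdmissible θ) (hn : 0 < n) (w : Equiv.Perm (Fin n)) :
    point d x ∈ polygon θ w ↔
      d ∈ Icc 0 (height θ) ∧ x ∈ Icc (profile θ 1 d) (profile θ w d) := by
  constructor
  · rintro ⟨p, hp, q, hq, hpd, hqd, hpx, hqx⟩
    obtain ⟨dp, xp, rfl⟩ := exists_eq_point p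
    obtain ⟨dq, xq, rfl⟩ := exists_eq_point q
    simp only [point_im, neg_inj, point_re] at hpd hqd hpx hqx
    subst hpd hqd
    obtain ⟨hd, rfl⟩ := (point_mem_path hθ hn 1).1 hp
    obtain ⟨-, rfl⟩ := (point_mem_path hθ hn w).1 hq
    exact ⟨hd, hpx, hqx⟩
  · rintro ⟨hd, hx⟩
    exact ⟨_, (point_mem_path hθ hn 1).2 ⟨hd, rfl⟩, _, (point_mem_path hθ hn w).2 ⟨hd, rfl⟩,
      rfl, rfl, hx.1, hx.2⟩

end

/-! ### Tiles -/

section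

open Set

variable {n : ℕ} {θ : Fin n → ℝ} {w : Equiv.Perm (Fin n)} {d x : ℝ}

namespace Tile

/-- The depth of the top vertex of a tile. -/
def upper (t : Tile n) : ℝ := -t.top.im

/-- The depth of the bottom vertex of a tile. -/
def lower (θ : Fin n → ℝ) (t : Tile n) : ℝ := t.upper + drop θ t.a + drop θ t.b

/-- The left boundary of a tile as a graph over the depth, prolonged above and below the tile. -/
def left (θ : Fin n → ℝ) (t : Tile n) : ℝ → ℝ := elbow θ t.top t.a t.b

/-- The right boundary of a tile as a graph over the depth, prolonged above and below the tile. -/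
def right (θ : Fin n → ℝ) (t : Tile n) : ℝ → ℝ := elbow θ t.top t.b t.a

variable (hθ : IsAdmissible θ) (t : Tile n)

theorem continuous_left : Continuous (t.left θ) := continuous_elbow _ _ _

theorem continuous_right : Continuous (t.right θ) := continuous_elbow _ _ _

include hθ

theorem slope_sub_pos : 0 < slope θ t.b - slope θ t.a := sub_pos.2 (hθ.slope_strictMono t.a_lt_b)

theorem upper_lt_lower : t.upper < t.lower θ := by
  have ha := hθ.drop_pos t.a
  have hb := hθ.drop_pos t.b
  unfold lower
  linarith

omit hθ in
theorem right_sub_left (d : ℝ) : t.right θ d - t.left θ d = (slope θ t.b - slope θ t.a) *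
    (d - t.upper - max 0 (d - t.upper - drop θ t.a) - max 0 (d - t.upper - drop θ t.b)) := by
  simp only [right, left, elbow, upper, sub_neg_eq_add]
  ring

theorem left_le_right_iff : t.left θ d ≤ t.right θ d ↔ d ∈ Icc t.upper (t.lower θ) := by
  have ha := hθ.drop_pos t.a
  have hb := hθ.drop_pos t.b
  rw [← sub_nonneg, right_sub_left, mul_nonneg_iff_of_pos_left (t.slope_sub_pos hθ), mem_Icc, lower]
  grind

theorem left_lt_right_iff : t.left θ d < t.right θ d ↔ d ∈ Ioo t.upper (t.lower θ) := by
  have ha := hθ.drop_pos t.a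
  have hb := hθ.drop_pos t.b
  rw [← sub_pos, right_sub_left, mul_pos_iff_of_pos_left (t.slope_sub_pos hθ), mem_Ioo, lower]
  grind

theorem point_mem_carrier_iff_exists : point d x ∈ t.carrier θ ↔
    ∃ R ∈ Icc 0 (drop θ t.a), ∃ S ∈ Icc 0 (drop θ t.b),
      d = t.upper + (R + S) ∧ x = t.top.re + (slope θ t.a * R + slope θ t.b * S) := by
  have ha := hθ.drop_pos t.a
  have hb := hθ.drop_pos t.b
  have hpoint : ∀ r s : ℝ, point d x = t.top + r • edgeVec θ t.a + s • edgeVec θ t.b ↔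
      d = t.upper + (r * drop θ t.a + s * drop θ t.b) ∧
        x = t.top.re + (slope θ t.a * (r * drop θ t.a) + slope θ t.b * (s * drop θ t.b)) := by
    intro r s
    rw [Complex.ext_iff, and_comm]
    simp only [point_re, point_im, Complex.add_re, Complex.add_im, Complex.smul_re, Complex.smul_im,
      edgeVec_re, edgeVec_im, ← hθ.slope_mul_drop, smul_eq_mul, upper]
    constructor <;> rintro ⟨h1, h2⟩ <;> constructor <;> linarith
  constructor
  · rintro ⟨r, ⟨hr0, hr1⟩, s, ⟨hs0, hs1⟩, h⟩
    exact ⟨r * drop θ t.a, ⟨by positivity, mul_le_of_le_one_left ha.le hr1⟩,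
      s * drop θ t.b, ⟨by positivity, mul_le_of_le_one_left hb.le hs1⟩, (hpoint r s).1 h⟩
  · rintro ⟨R, ⟨hR0, hR1⟩, S, ⟨hS0, hS1⟩, h⟩
    refine ⟨R / drop θ t.a, ⟨by positivity, (div_le_one ha).2 hR1⟩,
      S / drop θ t.b, ⟨by positivity, (div_le_one hb).2 hS1⟩, (hpoint _ _).2 ?_⟩
    rwa [div_mul_cancel₀ _ ha.ne', div_mul_cancel₀ _ hb.ne']

theorem point_mem_carrier :
    point d x ∈ t.carrier θ ↔ x ∈ Icc (t.left θ d) (t.right θ d) := by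
  have hs := t.slope_sub_pos hθ
  -- In the coordinates `R` and `S` along the two edge directions, the left boundary is where
  -- `S = 0` or `R` is maximal, and the right boundary is where `R = 0` or `S` is maximal.
  have hcoord : ∀ R S : ℝ, t.top.re + (slope θ t.a * R + slope θ t.b * S) ∈
      Icc (t.left θ (t.upper + (R + S))) (t.right θ (t.upper + (R + S))) ↔
        R ∈ Icc 0 (drop θ t.a) ∧ S ∈ Icc 0 (drop θ t.b) := by
    intro R S
    have hleft : t.top.re + (slope θ t.a * R + slope θ t.b * S) - t.left θ (t.upper + (R + S)) =
        (slope θ t.b - slope θ t.a) * (S - max 0 (R + S - drop θ t.a)) := by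
      simp only [left, elbow, upper]
      ring_nf
    have hright : t.right θ (t.upper + (R + S)) - (t.top.re + (slope θ t.a * R + slope θ t.b * S)) =
        (slope θ t.b - slope θ t.a) * (R - max 0 (R + S - drop θ t.b)) := by
      simp only [right, elbow, upper]
      ring_nf
    rw [mem_Icc, ← sub_nonneg, hleft, ← sub_nonneg (b := t.top.re + _), hright,
      mul_nonneg_iff_of_pos_left hs, mul_nonneg_iff_of_pos_left hs, sub_nonneg, sub_nonneg,
      max_le_iff, max_le_iff, mem_Icc, mem_Icc]
    constructor <;> rintro ⟨⟨h1, h2⟩, h3, h4⟩ <;> refine ⟨⟨?_, ?_⟩, ?_, ?_⟩ <;> linarith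
  rw [point_mem_carrier_iff_exists hθ]
  constructor
  · rintro ⟨R, hR, S, hS, rfl, rfl⟩
    exact (hcoord R S).2 ⟨hR, hS⟩
  · intro h
    obtain ⟨S, hS⟩ : ∃ S, S * (slope θ t.b - slope θ t.a) =
        x - t.top.re - slope θ t.a * (d - t.upper) := ⟨_, div_mul_cancel₀ _ hs.ne'⟩
    have hd : d = t.upper + (d - t.upper - S + S) := by ring
    have hx : x = t.top.re + (slope θ t.a * (d - t.upper - S) + slope θ t.b * S) := by
      linear_combination -hS
    rw [hx, hd, add_sub_cancel_left, add_sub_cancel_right] at h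
    obtain ⟨hR, hS⟩ := (hcoord _ _).1 (by convert h using 3)
    exact ⟨_, hR, S, hS, hd, hx⟩

theorem point_mem_interior_carrier :
    point d x ∈ interior (t.carrier θ) ↔ x ∈ Ioo (t.left θ d) (t.right θ d) := by
  constructor
  · intro h
    have hpre : point d ⁻¹' t.carrier θ = Icc (t.left θ d) (t.right θ d) :=
      ext fun y => t.point_mem_carrier hθ
    rw [← interior_Icc, ← hpre]
    exact preimage_interior_subset_interior_preimage
      (continuous_point_comp continuous_const continuous_id) h
  · have hopen : IsOpen {z : ℂ | t.left θ (-z.im) < z.re ∧ z.re < t.right θ (-z.im)} :=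
      (isOpen_lt (t.continuous_left.comp Complex.continuous_im.neg) Complex.continuous_re).inter
        (isOpen_lt Complex.continuous_re (t.continuous_right.comp Complex.continuous_im.neg))
    intro h
    refine interior_maximal (fun z hz => ?_) hopen (by simpa using h)
    obtain ⟨d', x', rfl⟩ := exists_eq_point z
    exact (t.point_mem_carrier hθ).2 (Ioo_subset_Icc_self (by simpa using hz))

theorem isClosed_carrier : IsClosed (t.carrier θ) := by
  have h : t.carrier θ = {z | t.left θ (-z.im) ≤ z.re ∧ z.re ≤ t.right θ (-z.im)} := by
    ext z
    obtain ⟨d, x, rfl⟩ := exists_eq_point z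
    simpa using t.point_mem_carrier hθ
  rw [h]
  exact (isClosed_le (t.continuous_left.comp Complex.continuous_im.neg) Complex.continuous_re).inter
    (isClosed_le Complex.continuous_re (t.continuous_right.comp Complex.continuous_im.neg))

end Tile

/-! ### Undoing a descent -/

namespace Descent

/-- The tile spanned by the two consecutive edges of a descent. Cutting it off turns the rightside
boundary of `w` into that of `k.swap`. -/
def tile (θ : Fin n → ℝ) (k : Descent w) : Tile n := ⟨pathVertex θ w k.pos, w k.snd, w k.fst, k.lt⟩

variable (k : Descent w)

theorem upper_tile : (k.tile θ).upper = depth θ w k.pos := rfl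

theorem lower_tile : (k.tile θ).lower θ = depth θ w (k.pos + 2) := by
  rw [depth_succ w k.pos_lt, depth_succ w (Nat.lt_of_succ_lt k.pos_lt)]
  exact add_right_comm _ _ _

theorem tile_inSwap {j k : Descent w} (h : j.Apart k) : (k.inSwap j h).tile θ = k.tile θ := by
  have hpos : k.pos ≠ j.pos + 1 := by unfold Apart at h; omega
  change Tile.mk _ (j.swap k.snd) (j.swap k.fst) _ = Tile.mk _ (w k.snd) (w k.fst) _
  simp only [swap_apply_fst h, swap_apply_snd h]
  congr 1
  exact pathVertex_swap j hpos

variable (hθ : IsAdmissible θ)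
include hθ

theorem right_tile (hd : d ∈ Icc (k.tile θ).upper ((k.tile θ).lower θ)) :
    (k.tile θ).right θ d = profile θ w d := by
  rw [upper_tile, lower_tile] at hd
  exact (profile_eq_elbow hθ w k.pos_lt hd).symm

theorem left_tile (hd : d ∈ Icc (k.tile θ).upper ((k.tile θ).lower θ)) :
    (k.tile θ).left θ d = profile θ k.swap d := by
  rw [upper_tile, lower_tile, ← depth_swap k (by omega), ← depth_swap k (by omega)] at hd
  rw [profile_eq_elbow hθ k.swap k.pos_lt hd, pathVertex_swap k (by omega), k.swap_fst, k.swap_snd]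
  rfl

theorem profile_swap (hd : d ∉ Ioo (k.tile θ).upper ((k.tile θ).lower θ)) :
    profile θ k.swap d = profile θ w d := by
  have hfst := k.swap_fst
  have hsnd := k.swap_snd
  have hfst_lt := Nat.lt_of_succ_lt k.pos_lt
  have hw := depth_succ (θ := θ) w hfst_lt
  have hw' := depth_succ (θ := θ) w k.pos_lt
  have hswap := depth_succ (θ := θ) k.swap hfst_lt
  rw [depth_swap k k.pos.lt_succ_self.ne, hfst] at hswap
  have h1 := hθ.drop_pos (w k.fst)
  have h2 := hθ.drop_pos (w k.snd)
  rw [profile, ← Equiv.sum_comp (Equiv.swap k.fst k.snd)]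
  refine Finset.sum_congr rfl fun i _ => ?_
  rw [k.swap_apply_swap]
  by_cases hi : i = k.fst ∨ i = k.snd
  · congr 1
    rw [upper_tile, lower_tile, mem_Ioo, not_and_or, not_lt, not_lt] at hd
    -- Both edges of the descent lie entirely below depth `d`, or both lie entirely above it.
    rcases hi with rfl | rfl
    · rw [Equiv.swap_apply_left]
      rcases hd with hd | hd
      · rw [max_zero_min_of_nonpos, max_zero_min_of_nonpos] <;> linarith
      · rw [max_zero_min_of_le h1.le, max_zero_min_of_le h1.le] <;> linarith
    · rw [Equiv.swap_apply_right, depth_swap k k.pos.lt_succ_self.ne]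
      rcases hd with hd | hd
      · rw [max_zero_min_of_nonpos, max_zero_min_of_nonpos] <;> linarith
      · rw [max_zero_min_of_le h2.le, max_zero_min_of_le h2.le] <;> linarith
  · rw [not_or] at hi
    rw [Equiv.swap_apply_of_ne_of_ne hi.1 hi.2, depth_swap k (Fin.val_ne_of_ne hi.2)]

theorem profile_swap_lt (hd : d ∈ Ioo (k.tile θ).upper ((k.tile θ).lower θ)) :
    profile θ k.swap d < profile θ w d := by
  rw [← k.left_tile hθ (Ioo_subset_Icc_self hd), ← k.right_tile hθ (Ioo_subset_Icc_self hd)]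
  exact ((k.tile θ).left_lt_right_iff hθ).2 hd

theorem profile_swap_le (d : ℝ) : profile θ k.swap d ≤ profile θ w d := by
  by_cases hd : d ∈ Ioo (k.tile θ).upper ((k.tile θ).lower θ)
  · exact (k.profile_swap_lt hθ hd).le
  · exact (k.profile_swap hθ hd).le

end Descent

theorem profile_one_le (hθ : IsAdmissible θ) (w : Equiv.Perm (Fin n)) (d : ℝ) :
    profile θ 1 d ≤ profile θ w d := by
  induction w using descent_induction with
  | step w ih =>
    cases isEmpty_or_nonempty (Descent w) with
    | inl h => rw [eq_one_of_isEmpty_descent h]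
    | inr h => exact (ih h.some).trans (h.some.profile_swap_le hθ d)

-- Undoing a descent that ends or begins inside the window, or straddles it, moves the boundary at
-- depth `d`; so all descents on the way to the identity act above or below the window.
theorem val_lt_iff_of_profile_eq (hθ : IsAdmissible θ) {j : ℕ} (hj : j < n)
    (hd : d ∈ Ioo (depth θ 1 j) (depth θ 1 (j + 1))) (h : profile θ w d = profile θ 1 d) {r : ℕ}
    (hr : r = j ∨ r = j + 1) (i : Fin n) : (w i).val < r ↔ i.val < r := by
  induction w using descent_induction generalizing r i with
  | step w ih =>
    cases isEmpty_or_nonempty (Descent w) with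
    | inl he => rw [eq_one_of_isEmpty_descent he, Equiv.Perm.one_apply]
    | inr he =>
      obtain ⟨k⟩ := he
      have hswap : profile θ k.swap d = profile θ 1 d :=
        le_antisymm ((k.profile_swap_le hθ d).trans_eq h) (profile_one_le hθ _ d)
      have hfix := fun {r : ℕ} hr i => ih k hswap (r := r) hr i
      have hdepth : ∀ r, r = j ∨ r = j + 1 → depth θ k.swap r = depth θ 1 r := fun r hr => by
        rw [depth, ← one_mul k.swap, pathVertex_mul 1 (hfix hr), depth]
      have hk : d ∉ Ioo (k.tile θ).upper ((k.tile θ).lower θ) := fun hk =>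
        (k.profile_swap_lt hθ hk).ne (hswap.trans h.symm)
      have hr' : r ≠ k.pos + 1 := by
        rintro rfl
        refine hk ⟨?_, ?_⟩
        · rw [k.upper_tile, ← depth_swap k (by omega)]
          refine lt_of_le_of_lt ?_ hd.1
          rw [← hdepth j (Or.inl rfl)]
          exact depth_le hθ _ (by omega) hj.le
        · rw [k.lower_tile, ← depth_swap k (by omega)]
          refine hd.2.trans_le ?_
          rw [← hdepth (j + 1) (Or.inr rfl)]
          exact depth_le hθ _ (by omega) k.pos_lt
      rw [← k.swap_fst_snd_val_lt_iff hr' i, ← hfix hr (Equiv.swap _ _ i), k.swap_apply_swap]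

theorem FullySupported.profile_one_lt (hw : FullySupported w) (hθ : IsAdmissible θ) (hn : 1 < n)
    {j : ℕ} (hj : j < n) (hd : d ∈ Ioo (depth θ 1 j) (depth θ 1 (j + 1))) :
    profile θ 1 d < profile θ w d := by
  refine (profile_one_le hθ w d).lt_of_ne fun h => ?_
  obtain ⟨r, hr, hr0, hrn⟩ : ∃ r, (r = j ∨ r = j + 1) ∧ 0 < r ∧ r < n := by
    rcases j.eq_zero_or_pos with rfl | h0
    exacts [⟨1, Or.inr rfl, one_pos, hn⟩, ⟨j, Or.inl rfl, h0, hj⟩]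
  refine hw r hr0 hrn ?_
  have hfix := val_lt_iff_of_profile_eq hθ hj hd h.symm hr
  exact (w.image_eq_preimage_symm _).trans <| ext fun i => by
    simpa using (hfix (w.symm i)).symm

end

/-! ### Dissections -/

section

open Set

variable {n : ℕ} {θ : Fin n → ℝ} {w : Equiv.Perm (Fin n)} {T : Finset (Tile n)} {d x : ℝ}

/-- The tiles of `T` dissect the region between the two boundary paths of `w`. This is the notion of
a rhombic tiling in which only the points strictly between the two paths have to be covered, so that
it makes sense, and is stable under undoing descents, when the paths touch. -/
structure Dissects (θ : Fin n → ℝ) (w : Equiv.Perm (Fin n)) (T : Finset (Tile n)) : Prop where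
  disjoint : (T : Set (Tile n)).PairwiseDisjoint fun t => interior (t.carrier θ)
  subset : ∀ t ∈ T, t.carrier θ ⊆ polygon θ w
  covers : ∀ d ∈ Icc 0 (height θ), ∀ x ∈ Ioo (profile θ 1 d) (profile θ w d),
    ∃ t ∈ T, point d x ∈ t.carrier θ

theorem dissects_one : Dissects θ 1 ∅ where
  disjoint := by simp
  subset := by simp
  covers := by simp

theorem IsTiling.dissects (hθ : IsAdmissible θ) (hn : 0 < n) (h : IsTiling θ w T) :
    Dissects θ w T where
  disjoint := h.1
  subset _ ht := (subset_biUnion_of_mem (u := Tile.carrier θ) ht).trans h.2.subset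
  covers d hd x hx := by
    have hmem := (point_mem_polygon hθ hn w).2 ⟨hd, Ioo_subset_Icc_self hx⟩
    simpa only [← h.2, mem_iUnion₂, exists_prop] using hmem

theorem Descent.polygon_swap_subset (hθ : IsAdmissible θ) (k : Descent w) :
    polygon θ k.swap ⊆ polygon θ w := by
  intro z hz
  have hn : 0 < n := pos_of_gt k.pos_lt
  obtain ⟨d, x, rfl⟩ := exists_eq_point z
  rw [point_mem_polygon hθ hn] at hz ⊢
  exact ⟨hz.1, hz.2.1, hz.2.2.trans (k.profile_swap_le hθ d)⟩

theorem Descent.Icc_upper_lower_subset (hθ : IsAdmissible θ) (k : Descent w) :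
    Icc (k.tile θ).upper ((k.tile θ).lower θ) ⊆ Icc 0 (height θ) := by
  rw [upper_tile, lower_tile]
  exact Icc_subset_Icc (depth_mem_Icc hθ w (Nat.lt_of_succ_lt k.pos_lt).le).1
    (depth_mem_Icc hθ w k.pos_lt).2

theorem Descent.carrier_tile_subset (hθ : IsAdmissible θ) (k : Descent w) :
    (k.tile θ).carrier θ ⊆ polygon θ w := by
  intro z hz
  obtain ⟨d, x, rfl⟩ := exists_eq_point z
  rw [Tile.point_mem_carrier hθ] at hz
  have hd := ((k.tile θ).left_le_right_iff hθ).1 (hz.1.trans hz.2)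
  rw [k.left_tile hθ hd, k.right_tile hθ hd] at hz
  exact (point_mem_polygon hθ (pos_of_gt k.pos_lt) w).2
    ⟨k.Icc_upper_lower_subset hθ hd, (profile_one_le hθ _ d).trans hz.1, hz.2⟩

theorem isClosed_biUnion_carrier (hθ : IsAdmissible θ) (T : Finset (Tile n)) :
    IsClosed (⋃ t ∈ T, t.carrier θ) :=
  T.finite_toSet.isClosed_biUnion fun t _ => t.isClosed_carrier hθ

namespace Dissects

variable (hθ : IsAdmissible θ) (h : Dissects θ w T)
include hθ h

theorem bounds {t : Tile n} (ht : t ∈ T) (hd : d ∈ Icc t.upper (t.lower θ)) :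
    d ∈ Icc 0 (height θ) ∧ profile θ 1 d ≤ t.left θ d ∧ t.right θ d ≤ profile θ w d := by
  have hle := (t.left_le_right_iff hθ).2 hd
  have hpoly := fun x (hx : x ∈ Icc (t.left θ d) (t.right θ d)) =>
    (point_mem_polygon hθ t.a.pos w).1 (h.subset t ht ((t.point_mem_carrier hθ).2 hx))
  have hleft := hpoly _ (left_mem_Icc.2 hle)
  have hright := hpoly _ (right_mem_Icc.2 hle)
  exact ⟨hleft.1, hleft.2.1, hright.2.2⟩

theorem right_le_left_or {s t : Tile n} (hs : s ∈ T) (ht : t ∈ T) (hst : s ≠ t)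
    (hds : d ∈ Ioo s.upper (s.lower θ)) (hdt : d ∈ Ioo t.upper (t.lower θ)) :
    s.right θ d ≤ t.left θ d ∨ t.right θ d ≤ s.left θ d := by
  have hs' := (s.left_lt_right_iff hθ).2 hds
  have ht' := (t.left_lt_right_iff hθ).2 hdt
  have hdisj : Disjoint (Ioo (s.left θ d) (s.right θ d)) (Ioo (t.left θ d) (t.right θ d)) :=
    disjoint_left.2 fun x hxs hxt => disjoint_left.1 (h.disjoint hs ht hst)
      ((s.point_mem_interior_carrier hθ).2 hxs) ((t.point_mem_interior_carrier hθ).2 hxt)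
  rw [Ioo_disjoint_Ioo, le_max_iff, min_le_iff, min_le_iff] at hdisj
  grind

theorem eq_of_right_eq {s t : Tile n} (hs : s ∈ T) (ht : t ∈ T)
    (hds : d ∈ Ioo s.upper (s.lower θ)) (hdt : d ∈ Ioo t.upper (t.lower θ))
    (heq : s.right θ d = t.right θ d) : s = t := by
  by_contra hst
  have hs' := (s.left_lt_right_iff hθ).2 hds
  have ht' := (t.left_lt_right_iff hθ).2 hdt
  rcases h.right_le_left_or hθ hs ht hst hds hdt with hle | hle <;> linarith

theorem point_mem_biUnion (hd : d ∈ Icc 0 (height θ)) (hlt : profile θ 1 d < profile θ w d)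
    (hx : x ∈ Icc (profile θ 1 d) (profile θ w d)) : point d x ∈ ⋃ t ∈ T, t.carrier θ := by
  have hmaps : MapsTo (point d) (Ioo (profile θ 1 d) (profile θ w d)) (⋃ t ∈ T, t.carrier θ) :=
    fun y hy => mem_iUnion₂.2 (by simpa only [exists_prop] using h.covers d hd y hy)
  rw [← closure_Ioo hlt.ne] at hx
  rw [← (isClosed_biUnion_carrier hθ T).closure_eq]
  exact hmaps.closure (continuous_point_comp continuous_const continuous_id) hx

theorem isTiling (hn : 1 < n) (hw : FullySupported w) : IsTiling θ w T := by
  refine ⟨h.disjoint, (iUnion₂_subset h.subset).antisymm fun z hz => ?_⟩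
  obtain ⟨d, x, rfl⟩ := exists_eq_point z
  obtain ⟨hd, hx⟩ := (point_mem_polygon hθ (pos_of_gt hn) w).1 hz
  obtain ⟨j, hj, hdj⟩ := exists_mem_Icc_depth hθ (pos_of_gt hn) 1 hd
  -- The paths may touch at depth `d`, but not at nearby depths: reach the point along the curve
  -- obtained by clamping `x` between the two paths.
  have hcurve : Continuous fun e => point e (max (profile θ 1 e) (min x (profile θ w e))) :=
    continuous_point_comp continuous_id
      ((continuous_profile 1).max (continuous_const.min (continuous_profile w)))
  have hmaps : MapsTo (fun e => point e (max (profile θ 1 e) (min x (profile θ w e))))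
      (Ioo (depth θ 1 j) (depth θ 1 (j + 1))) (⋃ t ∈ T, t.carrier θ) := fun e he =>
    h.point_mem_biUnion hθ
      (Icc_subset_Icc (depth_mem_Icc hθ 1 hj.le).1 (depth_mem_Icc hθ 1 hj).2
        (Ioo_subset_Icc_self he))
      (hw.profile_one_lt hθ hn hj he)
      ⟨le_max_left _ _, max_le (profile_one_le hθ w e) (min_le_right _ _)⟩
  rw [← closure_Ioo (depth_lt hθ 1 j.lt_succ_self hj).ne] at hdj
  have hmem : point d (max (profile θ 1 d) (min x (profile θ w d))) ∈ _ :=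
    hmaps.closure hcurve hdj
  rwa [min_eq_left hx.2, max_eq_right hx.1, (isClosed_biUnion_carrier hθ T).closure_eq] at hmem

omit h

theorem right_le_profile_swap {k : Descent w} (h : Dissects θ w T) (hk : k.tile θ ∈ T)
    {t : Tile n} (ht : t ∈ T) (hne : t ≠ k.tile θ) (hd : d ∈ Icc t.upper (t.lower θ)) :
    t.right θ d ≤ profile θ k.swap d := by
  rw [← closure_Ioo (t.upper_lt_lower hθ).ne] at hd
  refine le_on_closure (fun e he => ?_) t.continuous_right.continuousOn
    (continuous_profile _).continuousOn hd
  have hle := (h.bounds hθ ht (Ioo_subset_Icc_self he)).2.2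
  by_cases hek : e ∈ Ioo (k.tile θ).upper ((k.tile θ).lower θ)
  · rw [← k.left_tile hθ (Ioo_subset_Icc_self hek)]
    refine (h.right_le_left_or hθ ht hk hne he hek).resolve_right fun hle' => ?_
    rw [k.right_tile hθ (Ioo_subset_Icc_self hek)] at hle'
    exact ((t.left_lt_right_iff hθ).2 he).not_ge (hle.trans hle')
  · rwa [k.profile_swap hθ hek]

variable [DecidableEq (Tile n)] (k : Descent w)

theorem insert (h : Dissects θ k.swap T) : Dissects θ w (insert (k.tile θ) T) where
  disjoint := by
    rw [Finset.coe_insert]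
    refine h.disjoint.insert fun t ht _ => disjoint_left.2 fun z hzk hzt => ?_
    obtain ⟨d, x, rfl⟩ := exists_eq_point z
    rw [Tile.point_mem_interior_carrier hθ] at hzk hzt
    have hdk := ((k.tile θ).left_lt_right_iff hθ).1 (hzk.1.trans hzk.2)
    have hdt := (t.left_lt_right_iff hθ).1 (hzt.1.trans hzt.2)
    have hle := (h.bounds hθ ht (Ioo_subset_Icc_self hdt)).2.2
    rw [← k.left_tile hθ (Ioo_subset_Icc_self hdk)] at hle
    exact (hzt.2.trans_le hle).not_gt hzk.1
  subset t ht := by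
    obtain rfl | ht := Finset.mem_insert.1 ht
    exacts [k.carrier_tile_subset hθ, (h.subset t ht).trans (k.polygon_swap_subset hθ)]
  covers d hd x hx := by
    rcases lt_or_ge x (profile θ k.swap d) with hlt | hge
    · obtain ⟨t, ht, hmem⟩ := h.covers d hd x ⟨hx.1, hlt⟩
      exact ⟨t, Finset.mem_insert_of_mem ht, hmem⟩
    · have hdk : d ∈ Ioo (k.tile θ).upper ((k.tile θ).lower θ) := by
        by_contra hdk
        exact hx.2.not_ge ((k.profile_swap hθ hdk).symm.trans_le hge)
      refine ⟨_, Finset.mem_insert_self _ _, ((k.tile θ).point_mem_carrier hθ).2 ?_⟩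
      rw [k.left_tile hθ (Ioo_subset_Icc_self hdk), k.right_tile hθ (Ioo_subset_Icc_self hdk)]
      exact ⟨hge, hx.2.le⟩

variable {k} in
theorem erase (h : Dissects θ w T) (hk : k.tile θ ∈ T) :
    Dissects θ k.swap (T.erase (k.tile θ)) where
  disjoint := h.disjoint.subset (Finset.coe_subset.2 (Finset.erase_subset _ _))
  subset t ht z hz := by
    obtain ⟨hne, ht⟩ := Finset.mem_erase.1 ht
    obtain ⟨d, x, rfl⟩ := exists_eq_point z
    rw [Tile.point_mem_carrier hθ] at hz
    have hd := (t.left_le_right_iff hθ).1 (hz.1.trans hz.2)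
    have hbounds := h.bounds hθ ht hd
    exact (point_mem_polygon hθ t.a.pos _).2 ⟨hbounds.1, hbounds.2.1.trans hz.1,
      hz.2.trans (h.right_le_profile_swap hθ hk ht hne hd)⟩
  covers d hd x hx := by
    obtain ⟨t, ht, hmem⟩ := h.covers d hd x ⟨hx.1, hx.2.trans_le (k.profile_swap_le hθ d)⟩
    refine ⟨t, Finset.mem_erase.2 ⟨?_, ht⟩, hmem⟩
    rintro rfl
    rw [Tile.point_mem_carrier hθ] at hmem
    rw [k.left_tile hθ (((k.tile θ).left_le_right_iff hθ).1 (hmem.1.trans hmem.2))] at hmem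
    exact hmem.1.not_gt hx.2

end Dissects

theorem exists_dissects (hθ : IsAdmissible θ) (w : Equiv.Perm (Fin n)) : ∃ T, Dissects θ w T := by
  classical
  induction w using descent_induction with
  | step w ih =>
    cases isEmpty_or_nonempty (Descent w) with
    | inl h => exact eq_one_of_isEmpty_descent h ▸ ⟨∅, dissects_one⟩
    | inr h =>
      obtain ⟨T, hT⟩ := ih h.some
      exact ⟨_, hT.insert hθ h.some⟩

end

/-! ### Tiles on the rightside boundary -/

section

open Set Filter Topology

variable {n : ℕ} {θ : Fin n → ℝ} {w : Equiv.Perm (Fin n)} {T : Finset (Tile n)} {k : ℕ} {d x : ℝ}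

/-- On some interval that begins at `d` and extends to its right, `f` is affine with slope `α`.
Profiles and sides of tiles are compared through these germs. -/
def RightAffine (f : ℝ → ℝ) (d α : ℝ) : Prop := ∀ᶠ e in 𝓝[>] d, f e = f d + α * (e - d)

namespace RightAffine

variable {f g : ℝ → ℝ} {α β : ℝ}

theorem of_forall_mem_Icc {a b c : ℝ} (hd : d ∈ Ico a b)
    (h : ∀ e ∈ Icc a b, f e = c + α * (e - a)) : RightAffine f d α := by
  filter_upwards [Ioo_mem_nhdsGT hd.2] with e he
  rw [h d (Ico_subset_Icc_self hd), h e ⟨hd.1.trans he.1.le, he.2.le⟩]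
  ring

theorem eq_of_frequently (hf : RightAffine f d α) (hg : RightAffine g d β)
    (h : ∃ᶠ e in 𝓝[>] d, f e = g e) : f d = g d ∧ α = β := by
  have hline : ∃ᶠ e in 𝓝[>] d, f d + α * (e - d) = g d + β * (e - d) := by
    refine (h.and_eventually (hf.and hg)).mono ?_
    rintro e ⟨he, hfe, hge⟩
    rw [← hfe, he, hge]
  obtain ⟨e₁, he₁, hd₁⟩ := (hline.and_eventually self_mem_nhdsWithin).exists
  obtain ⟨e₂, he₂, hd₂⟩ := (hline.and_eventually (Ioo_mem_nhdsGT hd₁)).exists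
  have hαβ : α = β := mul_right_cancel₀ (sub_pos.2 hd₂.2).ne' (by linear_combination he₁ - he₂)
  subst hαβ
  exact ⟨add_right_cancel he₁, rfl⟩

theorem eventuallyEq (hf : RightAffine f d α) (hg : RightAffine g d β)
    (h : ∃ᶠ e in 𝓝[>] d, f e = g e) : f =ᶠ[𝓝[>] d] g := by
  obtain ⟨hd, rfl⟩ := hf.eq_of_frequently hg h
  filter_upwards [hf, hg] with e hfe hge
  rw [hfe, hge, hd]

end RightAffine

theorem rightAffine_profile (hθ : IsAdmissible θ) (w : Equiv.Perm (Fin n)) (hk : k < n)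
    (hd : d ∈ Ico (depth θ w k) (depth θ w (k + 1))) :
    RightAffine (profile θ w) d (slope θ (w ⟨k, hk⟩)) :=
  .of_forall_mem_Icc hd fun _ => profile_eq hθ w hk

theorem exists_rightAffine_profile (hθ : IsAdmissible θ) (w : Equiv.Perm (Fin n))
    (hd : d ∈ Ico 0 (height θ)) : ∃ α, RightAffine (profile θ w) d α := by
  obtain ⟨k, hk, hdk⟩ := exists_mem_Ico_depth w hd
  exact ⟨_, rightAffine_profile hθ w hk hdk⟩

theorem Tile.rightAffine_right (t : Tile n) (d : ℝ) : RightAffine (t.right θ) d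
    (slope θ (if d < t.upper + drop θ t.b then t.b else t.a)) := by
  split_ifs with h
  · filter_upwards [Ioo_mem_nhdsGT h] with e he
    have he' := he.2
    rw [upper] at h he'
    rw [right, elbow, elbow, max_eq_left (by linarith), max_eq_left (by linarith)]
    ring
  · filter_upwards [self_mem_nhdsWithin] with e he
    rw [upper] at h
    have he' : d < e := he
    rw [right, elbow, elbow, max_eq_right (by linarith), max_eq_right (by linarith)]
    ring

namespace Dissects

variable (hθ : IsAdmissible θ) (h : Dissects θ w T)
include hθ h

theorem profile_one_lt {t : Tile n} (ht : t ∈ T) (hd : d ∈ Ioo t.upper (t.lower θ)) :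
    profile θ 1 d < profile θ w d := by
  obtain ⟨-, hleft, hright⟩ := h.bounds hθ ht (Ioo_subset_Icc_self hd)
  exact hleft.trans_lt (((t.left_lt_right_iff hθ).2 hd).trans_le hright)

theorem exists_right_eq_profile (hd : d ∈ Icc 0 (height θ))
    (hlt : profile θ 1 d < profile θ w d) :
    ∃ t ∈ T, d ∈ Icc t.upper (t.lower θ) ∧ t.right θ d = profile θ w d := by
  obtain ⟨t, ht, hmem⟩ := mem_iUnion₂.1 (h.point_mem_biUnion hθ hd hlt (right_mem_Icc.2 hlt.le))
  rw [Tile.point_mem_carrier hθ] at hmem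
  have hdt := (t.left_le_right_iff hθ).1 (hmem.1.trans hmem.2)
  exact ⟨t, ht, hdt, (h.bounds hθ ht hdt).2.2.antisymm hmem.2⟩

theorem exists_right_eventuallyEq (hd : d ∈ Ico 0 (height θ))
    (hlt : ∃ᶠ e in 𝓝[>] d, profile θ 1 e < profile θ w e) :
    ∃ t ∈ T, d ∈ Ico t.upper (t.lower θ) ∧ t.right θ d = profile θ w d ∧
      t.right θ =ᶠ[𝓝[>] d] profile θ w := by
  have hfreq : ∃ᶠ e in 𝓝[>] d, ∃ t ∈ T, e ∈ Icc t.upper (t.lower θ) ∧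
      t.right θ e = profile θ w e :=
    (hlt.and_eventually (Ioo_mem_nhdsGT hd.2)).mono fun e he =>
      h.exists_right_eq_profile hθ ⟨hd.1.trans he.2.1.le, he.2.2.le⟩ he.1
  obtain ⟨t, ht, htfreq⟩ := (frequently_exists_finset T).1 hfreq
  have hupper : t.upper ≤ d := by
    by_contra! hd'
    obtain ⟨e, he, hde⟩ := (htfreq.and_eventually (Ioo_mem_nhdsGT hd')).exists
    exact he.1.1.not_gt hde.2
  have hlower : d < t.lower θ := by
    obtain ⟨e, he, hde⟩ := (htfreq.and_eventually self_mem_nhdsWithin).exists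
    exact hde.trans_le he.1.2
  obtain ⟨α, hα⟩ := exists_rightAffine_profile hθ w hd
  have hright := t.rightAffine_right (θ := θ) d
  have heq := htfreq.mono fun e he => he.2
  exact ⟨t, ht, ⟨hupper, hlower⟩, (hright.eq_of_frequently hα heq).1, hright.eventuallyEq hα heq⟩

theorem exists_right_eventuallyEq_upper (hd : d ∈ Icc 0 (height θ))
    (hlt : profile θ 1 d < profile θ w d) :
    ∃ t ∈ T, t.right θ =ᶠ[𝓝[>] t.upper] profile θ w := by
  by_contra! hnone
  suffices hsub : Icc 0 (height θ) ⊆ {e | profile θ 1 e = profile θ w e} from hlt.ne (hsub hd)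
  refine IsClosed.Icc_subset_of_forall_mem_nhdsWithin ?_ ?_ ?_
  · exact (isClosed_eq (continuous_profile _) (continuous_profile _)).inter isClosed_Icc
  · have hzero : ∀ v : Equiv.Perm (Fin n), profile θ v 0 = 0 := fun v => by
      simpa [depth_zero, pathVertex_zero] using profile_depth hθ v n.zero_le
    exact (hzero 1).trans (hzero w).symm
  · rintro e ⟨heq : profile θ 1 e = profile θ w e, he⟩
    by_contra hne
    have hfreq : ∃ᶠ e' in 𝓝[>] e, profile θ 1 e' < profile θ w e' :=
      (not_eventually.1 hne).mono fun e' he' => (profile_one_le hθ w e').lt_of_ne he'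
    obtain ⟨t, ht, het, -, htright⟩ := h.exists_right_eventuallyEq hθ he hfreq
    rcases het.1.eq_or_lt with rfl | hlt'
    · exact hnone t ht htright
    · exact (h.profile_one_lt hθ ht ⟨hlt', het.2⟩).ne heq

theorem exists_right_eqOn (hd : d ∈ Icc 0 (height θ)) (hlt : profile θ 1 d < profile θ w d) :
    ∃ t ∈ T, EqOn (t.right θ) (profile θ w) (Icc t.upper (t.lower θ)) := by
  classical
  obtain ⟨t₀, ht₀, hright₀⟩ := h.exists_right_eventuallyEq_upper hθ hd hlt
  -- Among the tiles whose right side starts on the boundary, the lowest one cannot be left by the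
  -- boundary: the next tile would start there, and further down.
  obtain ⟨t, ht, hmax⟩ := Finset.exists_max_image
    (T.filter fun t => t.right θ =ᶠ[𝓝[>] t.upper] profile θ w) Tile.upper
    ⟨t₀, Finset.mem_filter.2 ⟨ht₀, hright₀⟩⟩
  obtain ⟨ht, hright⟩ := Finset.mem_filter.1 ht
  have hlower := (h.bounds hθ ht (right_mem_Icc.2 (t.upper_lt_lower hθ).le)).1.2
  have hupper := (h.bounds hθ ht (left_mem_Icc.2 (t.upper_lt_lower hθ).le)).1.1
  refine ⟨t, ht, IsClosed.Icc_subset_of_forall_mem_nhdsWithin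
    (s := {e | t.right θ e = profile θ w e}) ?_ ?_ ?_⟩
  · exact (isClosed_eq t.continuous_right (continuous_profile _)).inter isClosed_Icc
  · obtain ⟨α, hα⟩ := exists_rightAffine_profile hθ w
      ⟨hupper, (t.upper_lt_lower hθ).trans_le hlower⟩
    exact ((t.rightAffine_right _).eq_of_frequently hα hright.frequently).1
  · rintro e ⟨heq : t.right θ e = profile θ w e, het⟩
    rcases het.1.eq_or_lt with rfl | hlt'
    · exact hright
    have hpos : ∀ᶠ e' in 𝓝[>] e, profile θ 1 e' < profile θ w e' := by
      filter_upwards [Ioo_mem_nhdsGT het.2] with e' he'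
      exact h.profile_one_lt hθ ht ⟨hlt'.trans he'.1, he'.2⟩
    obtain ⟨s, hs, hes, hseq, hsright⟩ := h.exists_right_eventuallyEq hθ
      ⟨hupper.trans hlt'.le, het.2.trans_le hlower⟩ hpos.frequently
    rcases hes.1.eq_or_lt with rfl | hlts
    · exact absurd (hmax s (Finset.mem_filter.2 ⟨hs, hsright⟩)) hlt'.not_ge
    · obtain rfl := h.eq_of_right_eq hθ hs ht ⟨hlts, hes.2⟩ ⟨hlt', het.2⟩ (hseq.trans heq.symm)
      exact hsright

end Dissects

namespace Tile

variable {t : Tile n} (hθ : IsAdmissible θ)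
  (hright : EqOn (t.right θ) (profile θ w) (Icc t.upper (t.lower θ)))
include hθ hright

theorem label_eq_of_right_eqOn (hk : k < n) (hd : d ∈ Ico (depth θ w k) (depth θ w (k + 1)))
    (hdt : d ∈ Ico t.upper (t.lower θ)) :
    w ⟨k, hk⟩ = if d < t.upper + drop θ t.b then t.b else t.a := by
  have heq : t.right θ =ᶠ[𝓝[>] d] profile θ w := by
    filter_upwards [Ioo_mem_nhdsGT hdt.2] with e he
    exact hright ⟨hdt.1.trans he.1.le, he.2.le⟩
  exact hθ.slope_strictMono.injective ((t.rightAffine_right d).eq_of_frequently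
    (rightAffine_profile hθ w hk hd) heq.frequently).2.symm

theorem exists_eq_tile_of_right_eqOn (hupper : 0 ≤ t.upper) (hlower : t.lower θ ≤ height θ) :
    ∃ k : Descent w, t = k.tile θ := by
  have ha := hθ.drop_pos t.a
  have hb := hθ.drop_pos t.b
  have hlow : t.lower θ = t.upper + drop θ t.b + drop θ t.a := add_right_comm _ _ _
  obtain ⟨j, hj, hju⟩ := exists_mem_Ico_depth w ⟨hupper, (t.upper_lt_lower hθ).trans_le hlower⟩
  have hwj : w ⟨j, hj⟩ = t.b := by
    rw [label_eq_of_right_eqOn hθ hright hj hju ⟨le_rfl, t.upper_lt_lower hθ⟩,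
      if_pos (lt_add_of_pos_right _ hb)]
  have hsucc := depth_succ (θ := θ) w hj
  rw [hwj] at hsucc
  have hj' : j + 1 < n := by
    by_contra hn
    obtain rfl : n = j + 1 := by omega
    rw [← depth_last w] at hlower
    linarith [hju.1]
  have hnext : depth θ w (j + 1) ∈ Ico (depth θ w (j + 1)) (depth θ w (j + 2)) :=
    ⟨le_rfl, depth_lt hθ w (j + 1).lt_succ_self hj'⟩
  have hwj' := label_eq_of_right_eqOn hθ hright hj' hnext ⟨hju.2.le, by linarith [hju.1]⟩
  have htop : depth θ w j = t.upper := by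
    refine hju.1.eq_of_not_lt fun hlt => ?_
    rw [if_pos (by linarith), ← hwj] at hwj'
    simpa using w.injective hwj'
  rw [if_neg (by linarith)] at hwj'
  refine ⟨⟨j, hj', by rw [hwj, hwj']; exact t.a_lt_b⟩, ?_⟩
  have htop_re : t.top.re = (pathVertex θ w j).re := by
    rw [← profile_depth hθ w hj.le, htop, ← hright (left_mem_Icc.2 (t.upper_lt_lower hθ).le), right,
      elbow, upper, max_eq_left (by linarith)]
    ring
  obtain ⟨p, a, b, hab⟩ := t
  rw [Descent.tile, Tile.mk.injEq]
  exact ⟨Complex.ext htop_re (neg_injective htop.symm), hwj'.symm, hwj.symm⟩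

end Tile

theorem Dissects.exists_tile_mem [h : Nonempty (Descent w)] (hθ : IsAdmissible θ)
    (hT : Dissects θ w T) : ∃ k : Descent w, k.tile θ ∈ T := by
  obtain ⟨k⟩ := h
  obtain ⟨d, hd⟩ := exists_between ((k.tile θ).upper_lt_lower hθ)
  obtain ⟨t, ht, hright⟩ := hT.exists_right_eqOn hθ
    (k.Icc_upper_lower_subset hθ (Ioo_subset_Icc_self hd))
    ((profile_one_le hθ k.swap d).trans_lt (k.profile_swap_lt hθ hd))
  have hle := (t.upper_lt_lower hθ).le
  obtain ⟨j, rfl⟩ := Tile.exists_eq_tile_of_right_eqOn hθ hright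
    (hT.bounds hθ ht (left_mem_Icc.2 hle)).1.1 (hT.bounds hθ ht (right_mem_Icc.2 hle)).1.2
  exact ⟨j, ht⟩

theorem Descent.IsRecord.tile_mem (hθ : IsAdmissible θ) {k : Descent w} (hk : k.IsRecord)
    (h : Dissects θ w T) : k.tile θ ∈ T := by
  classical
  induction w using descent_induction generalizing T with
  | step w ih =>
    have : Nonempty (Descent w) := ⟨k⟩
    obtain ⟨j, hj⟩ := h.exists_tile_mem hθ
    rcases eq_or_ne j k with rfl | hjk
    · exact hj
    · have hapart := Descent.apart_of_not_adjacent hjk (hk.not_adjacent j).1 (hk.not_adjacent j).2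
      rw [← Descent.tile_inSwap hapart]
      have hrec := (Descent.isRecord_inSwap_iff hapart).2 hk
      exact Finset.mem_of_mem_erase (ih j hrec (h.erase hθ hj))

end

/-! ### Forced tiles -/

section

open Set

variable {n : ℕ} {θ : Fin n → ℝ} {w : Equiv.Perm (Fin n)} {T : Finset (Tile n)} {d x : ℝ}

theorem label_eq_of_segment_subset (hθ : IsAdmissible θ) {p q : ℂ} {i j : Fin n}
    (h : segment ℝ p (p + edgeVec θ i) ⊆ segment ℝ q (q + edgeVec θ j)) : i = j := by
  have hdrop := hθ.drop_pos i
  have hmem : ∀ e ∈ Icc (-p.im) (-p.im + drop θ i),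
      p.re + slope θ i * (e + p.im) = q.re + slope θ j * (e + q.im) := fun e he =>
    ((point_mem_segment_edgeVec hθ q j).1
      (h ((point_mem_segment_edgeVec hθ p i).2 ⟨he, rfl⟩))).2
  have h0 := hmem _ (left_mem_Icc.2 (by linarith))
  have h1 := hmem _ (right_mem_Icc.2 (by linarith))
  exact hθ.slope_strictMono.injective
    (mul_right_cancel₀ hdrop.ne' (by linear_combination h1 - h0))

namespace Tile

theorem subset_carrier_of_mem_edges {t : Tile n} {s : Set ℂ} (hs : s ∈ t.edges θ) :
    s ⊆ t.carrier θ := by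
  rcases hs with rfl | rfl | rfl | rfl <;> rw [segment_eq_image'] <;> rintro _ ⟨r, hr, rfl⟩
  · exact ⟨r, hr, 0, left_mem_Icc.2 zero_le_one, by simp⟩
  · exact ⟨0, left_mem_Icc.2 zero_le_one, r, hr, by simp⟩
  · exact ⟨1, right_mem_Icc.2 zero_le_one, r, hr, by simp⟩
  · exact ⟨r, hr, 1, right_mem_Icc.2 zero_le_one, by dsimp only; module⟩

theorem label_eq_of_pathEdge_mem_edges (hθ : IsAdmissible θ) {t : Tile n} {k : ℕ} (hk : k < n)
    (h : pathEdge θ w k ∈ t.edges θ) : w ⟨k, hk⟩ = t.a ∨ w ⟨k, hk⟩ = t.b := by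
  rw [pathEdge_eq w hk] at h
  rcases h with h | h | h | h
  · exact Or.inl (label_eq_of_segment_subset hθ h.subset)
  · exact Or.inr (label_eq_of_segment_subset hθ h.subset)
  · exact Or.inr (label_eq_of_segment_subset hθ h.subset)
  · rw [mem_singleton_iff, add_right_comm] at h
    exact Or.inl (label_eq_of_segment_subset hθ h.subset)

theorem profile_mem_of_pathEdge_mem_edges (hθ : IsAdmissible θ) {t : Tile n} {k : ℕ} (hk : k < n)
    (h : pathEdge θ w k ∈ t.edges θ) (hd : d ∈ Icc (depth θ w k) (depth θ w (k + 1))) :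
    profile θ w d ∈ Icc (t.left θ d) (t.right θ d) :=
  (t.point_mem_carrier hθ).1
    (subset_carrier_of_mem_edges h ((point_mem_pathEdge hθ w hk).2 ⟨hd, rfl⟩))

end Tile

namespace Descent

theorem isRightPerimeter_tile (k : Descent w) : IsRightPerimeter θ w (k.tile θ) := by
  have hk := Nat.lt_of_succ_lt k.pos_lt
  refine ⟨k.pos, k.pos_lt, Or.inr (Or.inl (pathEdge_eq w hk)), Or.inr (Or.inr (Or.inr ?_))⟩
  rw [mem_singleton_iff, pathEdge_eq w k.pos_lt, pathVertex_succ w hk,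
    add_right_comm _ (edgeVec _ _)]
  rfl

theorem tile_injective : Function.Injective (tile θ : Descent w → Tile n) := fun _ _ h =>
  Descent.ext (congrArg Fin.val (w.injective (congrArg Tile.b h)))

end Descent

namespace Dissects

variable (hθ : IsAdmissible θ) (h : Dissects θ w T)
include hθ h

theorem exists_eq_tile_of_isRightPerimeter {t : Tile n} (ht : t ∈ T)
    (hright : IsRightPerimeter θ w t) : ∃ k : Descent w, t = k.tile θ := by
  obtain ⟨k, hk, hedge, hedge'⟩ := hright
  have hk' := Nat.lt_of_succ_lt hk
  have hmem := fun {e : ℝ} => Tile.profile_mem_of_pathEdge_mem_edges (d := e) hθ hk' hedge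
  have hmem' := fun {e : ℝ} => Tile.profile_mem_of_pathEdge_mem_edges (d := e) hθ hk hedge'
  have htop := hmem (left_mem_Icc.2 (depth_le hθ w k.le_succ hk'))
  have hbot := hmem' (right_mem_Icc.2 (depth_le hθ w (k + 1).le_succ hk))
  have hupper := ((t.left_le_right_iff hθ).1 (htop.1.trans htop.2)).1
  have hlower := ((t.left_le_right_iff hθ).1 (hbot.1.trans hbot.2)).2
  have hdepth : depth θ w (k + 1 + 1) = depth θ w k + (drop θ t.a + drop θ t.b) := by
    have hne : w ⟨k, hk'⟩ ≠ w ⟨k + 1, hk⟩ := w.injective.ne (Fin.ne_of_val_ne k.lt_succ_self.ne)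
    rw [depth_succ w hk, depth_succ w hk']
    rcases Tile.label_eq_of_pathEdge_mem_edges hθ hk' hedge with ha | ha <;>
      rcases Tile.label_eq_of_pathEdge_mem_edges hθ hk hedge' with hb | hb
    · exact absurd (ha.trans hb.symm) hne
    · rw [ha, hb, add_assoc]
    · rw [ha, hb, add_assoc, add_comm (drop θ t.b)]
    · exact absurd (ha.trans hb.symm) hne
  have heqOn : EqOn (t.right θ) (profile θ w) (Icc t.upper (t.lower θ)) := fun e he => by
    refine (h.bounds hθ ht he).2.2.antisymm ?_
    rw [Tile.lower] at he hlower
    rcases le_total e (depth θ w (k + 1)) with hle | hle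
    · exact (hmem ⟨by linarith [he.1], hle⟩).2
    · exact (hmem' ⟨hle, by linarith [he.2]⟩).2
  have hle := (t.upper_lt_lower hθ).le
  exact Tile.exists_eq_tile_of_right_eqOn hθ heqOn
    (h.bounds hθ ht (left_mem_Icc.2 hle)).1.1 (h.bounds hθ ht (right_mem_Icc.2 hle)).1.2

theorem pos_ne_pos_add_one {j k : Descent w} (hj : j.tile θ ∈ T) (hk : k.tile θ ∈ T) :
    k.pos ≠ j.pos + 1 := by
  intro hpos
  obtain ⟨d, hd⟩ := exists_between (depth_lt hθ w k.pos.lt_succ_self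
    (Nat.lt_of_succ_lt k.pos_lt))
  have hdj : d ∈ Ioo (j.tile θ).upper ((j.tile θ).lower θ) := by
    rw [j.upper_tile, j.lower_tile]
    exact ⟨(depth_le hθ w (by omega) (Nat.lt_of_succ_lt k.pos_lt).le).trans_lt hd.1,
      hd.2.trans_eq (by rw [hpos])⟩
  have hdk : d ∈ Ioo (k.tile θ).upper ((k.tile θ).lower θ) := by
    rw [k.upper_tile, k.lower_tile]
    exact ⟨hd.1, hd.2.trans_le (depth_le hθ w (Nat.le_succ _) k.pos_lt)⟩
  have heq := Descent.tile_injective (h.eq_of_right_eq hθ hj hk hdj hdk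
    ((j.right_tile hθ (Ioo_subset_Icc_self hdj)).trans
      (k.right_tile hθ (Ioo_subset_Icc_self hdk)).symm))
  exact j.pos.lt_succ_self.ne ((congrArg Descent.pos heq).trans hpos)

theorem apart {j k : Descent w} (hj : j.tile θ ∈ T) (hk : k.tile θ ∈ T) (hjk : j ≠ k) :
    j.Apart k :=
  Descent.apart_of_not_adjacent hjk (h.pos_ne_pos_add_one hθ hk hj) (h.pos_ne_pos_add_one hθ hj hk)

end Dissects

theorem Descent.isRecord_of_forall_tile_mem (hθ : IsAdmissible θ) {k : Descent w}
    (h : ∀ T, Dissects θ w T → k.tile θ ∈ T) : k.IsRecord := by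
  classical
  induction w using descent_induction with
  | step w ih =>
    by_cases hall : ∀ j : Descent w, j = k
    · exact isRecord_of_forall_eq hall
    obtain ⟨j, hjk⟩ := not_forall.1 hall
    obtain ⟨T, hT⟩ := exists_dissects hθ j.swap
    have hins := hT.insert hθ j
    have hapart := hins.apart hθ (Finset.mem_insert_self _ _) (h _ hins) hjk
    refine (isRecord_inSwap_iff hapart).1 (ih j fun S hS => ?_)
    rw [tile_inSwap hapart]
    exact Finset.mem_of_mem_insert_of_ne (h _ (hS.insert hθ j)) fun he =>
      hjk (tile_injective he).symm

namespace FullySupported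

theorem isForcedRightPerimeter_iff (hw : FullySupported w) (hθ : IsAdmissible θ) {t : Tile n} :
    IsForcedRightPerimeter θ w t ↔ ∃ k : Descent w, k.IsRecord ∧ k.tile θ = t := by
  have hab : t.a.val < t.b.val := t.a_lt_b
  have hn : 1 < n := (Nat.succ_le_of_lt (pos_of_gt hab)).trans_lt t.b.isLt
  constructor
  · intro h
    obtain ⟨T, hT⟩ := exists_dissects hθ w
    obtain ⟨ht, hright⟩ := h T (hT.isTiling hθ hn hw)
    obtain ⟨k, rfl⟩ := hT.exists_eq_tile_of_isRightPerimeter hθ ht hright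
    exact ⟨k, Descent.isRecord_of_forall_tile_mem hθ fun S hS =>
      (h S (hS.isTiling hθ hn hw)).1, rfl⟩
  · rintro ⟨k, hk, rfl⟩ T hT
    exact ⟨hk.tile_mem hθ (hT.dissects hθ (pos_of_gt hn)), k.isRightPerimeter_tile⟩

theorem numForcedRight_eq_encard_isRecord (hw : FullySupported w) (hθ : IsAdmissible θ) :
    numForcedRight θ w = {k : Descent w | k.IsRecord}.encard := by
  rw [numForcedRight, ← Descent.tile_injective.encard_image]
  exact congrArg encard (ext fun t => hw.isForcedRightPerimeter_iff hθ)

end FullySupported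

end

end Elnitsky

end

theorem theorem5 (m : ℕ) (θ : Fin (2 * m) → ℝ) (hθ : Elnitsky.IsAdmissible θ) :
    IsGreatest
        {c : ℕ∞ | ∃ w : Equiv.Perm (Fin (2 * m)),
          Elnitsky.FullySupported w ∧ c = Elnitsky.numForcedRight θ w}
        (m : ℕ∞) ∧
      ∀ w : Equiv.Perm (Fin (2 * m)), Elnitsky.FullySupported w →
        (Elnitsky.numForcedRight θ w = (m : ℕ∞) ↔
          (∀ k : Fin m, w ⟨2 * k.val, by omega⟩ > w ⟨2 * k.val + 1, by omega⟩) ∧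
            StrictMono (fun k : Fin m => w ⟨2 * k.val, by omega⟩) ∧
            StrictMono (fun k : Fin m => w ⟨2 * k.val + 1, by omega⟩)) := by
  refine ⟨⟨?_, ?_⟩, fun w hw => ?_⟩
  · refine ⟨Elnitsky.interleave m, Elnitsky.fullySupported_interleave, ?_⟩
    rw [Elnitsky.fullySupported_interleave.numForcedRight_eq_encard_isRecord hθ,
      Elnitsky.encard_isRecord_interleave]
  · rintro _ ⟨w, hw, rfl⟩
    rw [hw.numForcedRight_eq_encard_isRecord hθ]
    simpa using Elnitsky.Descent.encard_isRecord_le w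
  · rw [hw.numForcedRight_eq_encard_isRecord hθ]
    exact Elnitsky.Descent.encard_isRecord_eq_iff.trans Elnitsky.Descent.forall_exists_isRecord_iff
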